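/- **Setting.** Let $a,b\ge 0$. Let $\mathcal A$ and $\mathcal B$ be the sets of density matrices (positive semidefinite, trace one) of size $2^a\times 2^a$ and $2^b\times 2^b$, and $\mathcal Z=\mathcal A\times\mathcal B$, with the inner product $\langle z,w\rangle$ and the norm $\|\cdot\|$ the Hilbert–Schmidt inner product and the Frobenius norm on pairs. A quantum zero-sum game is given by a finite POVM $(P_\omega)_{\omega\in\Omega}$ on $\mathbb C^{2^a}\otimes\mathbb C^{2^b}$ and utilities $\mathcal U(\omega)\in[-1,1]$. Put $U=\sum_\omega\mathcal U(\omega)P_\omega$, $p(\alpha,\beta)=\operatorname{tr}(U^\dagger(\alpha\otimes\beta))=\operatorname{tr}(\alpha F(\beta))$ with $F(\beta)=\operatorname{Tr}_{\mathcal B}[U^\dagger(I\otimes\beta)]$ and $F^*(\alpha)=\operatorname{Tr}_{\mathcal A}[U^\dagger(\alpha\otimes I)]$, and let $\mathcal F(\alpha,\beta)=(F(\beta),-F^*(\alpha))$, with operator norm $\|\mathcal F\|=\sup\{\langle \mathcal F(z),w\rangle:\|z\|=\|w\|=1\}$ over pairs of Hermitian matrices. The duality gap is $\mathrm{gap}(\alpha,\beta)=\max_{\beta'\in\mathcal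 B}p(\alpha,\beta')-\min_{\alpha'\in\mathcal A}p(\alpha',\beta)$. An $\epsilon$-equilibrium is a $z\in\mathcal Z$ with $\mathrm{gap}(z)\le\epsilon$. Let $\mathrm{dist}(z)$ be the distance from $z$ to $\operatorname{argmin}_{\mathcal Z}\mathrm{gap}$. The error-bound modulus is $$\delta(F)=\sup\{\delta>0:\ \mathrm{dist}(z)\le \mathrm{gap}(z)/\delta\ \text{ for all } z\in\mathcal Z\}\in[0,\infty]\qquad(\sup\emptyset=0),$$ and $\kappa(F)=\|\mathcal F\|/\delta(F)\in[0,\infty]$, where $x/0=+\infty$ for $x>0$ and $x/\infty=0$. **Algorithm.** Fix $\tilde z\in\mathcal Z$, let $r(z)=\frac12\|z-\tilde z\|^2$ and $D_{\max}=\max_{\mathcal Z}r$. The procedure *Smoothing*$(z_0,e)$ sets $\mu=e/(2D_{\max})$, $L=\|\mathcal F\|^2/\mu$, $w_0=z_0$, and in its first-order iterations $k=0,1,2,\dots$ computes $$u_k=\tfrac{2}{k+2}w_k+\tfrac{k}{k+2}z_k,\qquad g_k=\mathcal F\Big(\operatorname*{argmax}_{(\alpha',\beta')\in\mathcal Z}\{p(u_k^{\mathcal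 A},\beta')-p(\alpha',u_k^{\mathcal B})-\mu\, r(\alpha',\beta')\}\Big),$$ where $u_k=(u_k^{\mathcal A},u_k^{\mathcal B})$, and $$z_{k+1}=\operatorname*{argmin}_{y\in\mathcal Z}\{\langle g_k,y-u_k\rangle+\tfrac L2\|y-u_k\|^2\},\qquad w_{k+1}=\operatorname*{argmin}_{y\in\mathcal Z}\Big\{\sum_{i\le k}\tfrac{i+1}{2}\langle g_i,y\rangle+\tfrac L2\|y-z_0\|^2\Big\}.$$ It returns the first $z_{k+1}$ with $\mathrm{gap}(z_{k+1})\le e$. For $\gamma>1$, $\epsilon>0$ and a starting point $z_0\in\mathcal Z$, *IterSmooth* starts with $z=z_0$, $e=\mathrm{gap}(z_0)$; as long as $\mathrm{gap}(z)>\epsilon$ it replaces $e$ by $e/\gamma$ and then $z$ by Smoothing$(z,e)$; then it returns $z$. Its iteration count is the total number of first-order iterations over all calls of Smoothing. **Theorem.** Let $\gamma>1$. 1. There is a constant $C>0$, depending only on $\gamma$, such that for all $a,b$, all quantum zero-sum games, all $\tilde z,z_0\in\mathcal Z$ and all $0<\epsilon\le\|\mathcal F\|/2$, IterSmooth terminates,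 returns an $\epsilon$-equilibrium, and uses at most $$C\,\kappa(F)\,\ln(\|\mathcal F\|/\epsilon)$$ first-order iterations. 2. For all $a,b$, all quantum zero-sum games, all $\tilde z,z_0\in\mathcal Z$ and all $\epsilon>0$, IterSmooth terminates, returns an $\epsilon$-equilibrium, and uses at most $$\max\Big\{0,\Big\lceil\frac{\ln(2\|\mathcal F\|/\epsilon)}{\ln\gamma}\Big\rceil\Big\}\cdot\left\lceil\frac{2\sqrt2\,\gamma\,\|\mathcal F\|\,\sqrt{D_{\max}}}{\delta(F)}\right\rceil$$ first-order iterations (if $\mathcal F=0$ the count is $0$; $0\cdot\infty=0$). If $\delta(F)=0$, so that the game admits no error bound, a bound in which $\delta(F)$ or $\kappa(F)$ appears with a nonzero cofactor is $+\infty$; termination and the correctness of the output are still asserted. -/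

import Mathlib

open scoped ENNReal Kronecker ComplexOrder

noncomputable section

/-- Complex matrices acting on the state space of `d` qubits. -/
abbrev QMat (d : ℕ) : Type := Matrix (Fin (2 ^ d)) (Fin (2 ^ d)) ℂ

/-- Pairs of matrices, one for each of the two players. -/
abbrev JointMat (a b : ℕ) : Type := QMat a × QMat b

/-- The density matrices on `d` qubits (the spectraplex). -/
def spectraplex (d : ℕ) : Set (QMat d) := {A | A.PosSemidef ∧ A.trace = 1}

/-- The joint state space: pairs of density matrices. -/
def jointStates (a b : ℕ) : Set (JointMat a b) := spectraplex a ×ˢ spectraplex b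

/-- Pairs of Hermitian matrices. -/
def jointHermitian (a b : ℕ) : Set (JointMat a b) := {z | z.1.IsHermitian ∧ z.2.IsHermitian}

/-- The Hilbert-Schmidt inner product `tr (A† B)`; on Hermitian matrices it is a real number, and
the real part does not lose anything. -/
def hsInner {d : ℕ} (A B : QMat d) : ℝ := ((A.conjTranspose * B).trace).re

/-- The Hilbert-Schmidt inner product on pairs. -/
def jointInner {a b : ℕ} (z w : JointMat a b) : ℝ := hsInner z.1 w.1 + hsInner z.2 w.2

/-- The Frobenius norm on pairs. -/
def jointNorm {a b : ℕ} (z : JointMat a b) : ℝ := Real.sqrt (jointInner z z)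

/-- A point of `S` that minimizes `f` over `S` (if there is one). -/
def argminOn {E : Type*} [Nonempty E] (f : E → ℝ) (S : Set E) : E :=
  Classical.epsilon fun x => x ∈ S ∧ IsMinOn f S x

/-- A point of `S` that maximizes `f` over `S` (if there is one). -/
def argmaxOn {E : Type*} [Nonempty E] (f : E → ℝ) (S : Set E) : E :=
  Classical.epsilon fun x => x ∈ S ∧ IsMaxOn f S x

/-- A non-interactive refereed quantum zero-sum game: Alice sends an `a`-qubit state, Bob sends a
`b`-qubit state, and the referee measures the product state with a finite POVM and pays a utility
in `[-1, 1]` that depends on the outcome. -/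
structure QuantumGame (a b : ℕ) (Ω : Type*) [Fintype Ω] where
  povm : Ω → Matrix (Fin (2 ^ a) × Fin (2 ^ b)) (Fin (2 ^ a) × Fin (2 ^ b)) ℂ
  povm_posSemidef : ∀ ω, (povm ω).PosSemidef
  povm_sum : ∑ ω, povm ω = 1
  utility : Ω → ℝ
  utility_mem : ∀ ω, utility ω ∈ Set.Icc (-1 : ℝ) 1

namespace QuantumGame

variable {a b : ℕ} {Ω : Type*} [Fintype Ω] (G : QuantumGame a b Ω)

/-- The payoff observable `U = ∑ ω, 𝒰(ω) P_ω`. -/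
def observable : Matrix (Fin (2 ^ a) × Fin (2 ^ b)) (Fin (2 ^ a) × Fin (2 ^ b)) ℂ :=
  ∑ ω, (G.utility ω : ℂ) • G.povm ω

/-- The expected payoff `tr (U† (α ⊗ β))`; the first player minimizes it, the second maximizes. -/
def payoff (α : QMat a) (β : QMat b) : ℝ := ((G.observable.conjTranspose * (α ⊗ₖ β)).trace).re

/-- The superoperator `F(β) = Tr_B [U† (1 ⊗ β)]`, so that `payoff α β = tr (α F(β))`. -/
def superop (β : QMat b) : QMat a := Matrix.of fun i j =>
  ∑ k, (G.observable.conjTranspose * ((1 : QMat a) ⊗ₖ β)) (i, k) (j, k)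

/-- The adjoint superoperator `F*(α) = Tr_A [U† (α ⊗ 1)]`, so that `payoff α β = tr (F*(α) β)`. -/
def superopAdj (α : QMat a) : QMat b := Matrix.of fun i j =>
  ∑ k, (G.observable.conjTranspose * (α ⊗ₖ (1 : QMat b))) (k, i) (k, j)

/-- The joint payoff gradient `(F(β), -F*(α))`. -/
def grad (z : JointMat a b) : JointMat a b := (G.superop z.2, -G.superopAdj z.1)

/-- The operator norm of the joint payoff gradient with respect to the Frobenius norm. -/
def opNorm : ℝ := sSup {t | ∃ z ∈ jointHermitian a b, ∃ w ∈ jointHermitian a b,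
  jointNorm z = 1 ∧ jointNorm w = 1 ∧ t = jointInner (G.grad z) w}

/-- The upper value function `max_β payoff α β`. -/
def upperValue (α : QMat a) : ℝ := sSup ((fun β => G.payoff α β) '' spectraplex b)

/-- The lower value function `min_α payoff α β`. -/
def lowerValue (β : QMat b) : ℝ := sInf ((fun α => G.payoff α β) '' spectraplex a)

/-- The duality gap. -/
def gap (z : JointMat a b) : ℝ := G.upperValue z.1 - G.lowerValue z.2

/-- `z` is an `ε`-equilibrium: a joint state whose duality gap is at most `ε`. -/
def IsEpsEquilibrium (ε : ℝ) (z : JointMat a b) : Prop := z ∈ jointStates a b ∧ G.gap z ≤ ε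

/-- The set of joint states of minimal duality gap. -/
def opt : Set (JointMat a b) := {z | z ∈ jointStates a b ∧ IsMinOn G.gap (jointStates a b) z}

/-- The Frobenius distance to the set of optimal joint states. -/
def dist (z : JointMat a b) : ℝ := sInf ((fun w => jointNorm (z - w)) '' G.opt)

/-- The error-bound modulus: the supremum, in `[0, ∞]`, of all `d > 0` such that
`dist z ≤ gap z / d` for all joint states `z`. It is `0` if there is no such `d`, and `∞` if every
joint state is optimal. -/
def modulus : ℝ≥0∞ :=
  ⨆ (d : ℝ) (_ : 0 < d ∧ ∀ z ∈ jointStates a b, G.dist z ≤ G.gap z / d), ENNReal.ofReal d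

/-- The condition measure `κ = ‖F‖ / δ`, in `[0, ∞]`. -/
def condMeasure : ℝ≥0∞ := ENNReal.ofReal G.opNorm / G.modulus

end QuantumGame

/-- The quadratic regularizer with reference point `zref`. -/
def regularizer {a b : ℕ} (zref z : JointMat a b) : ℝ := jointNorm (z - zref) ^ 2 / 2

/-- The maximum of the regularizer over the joint state space. -/
def regMax {a b : ℕ} (zref : JointMat a b) : ℝ := sSup (regularizer zref '' jointStates a b)

/-- The state of the accelerated scheme: the current iterate, the current dual-averaging point, and
the weighted sum of the gradients seen so far. -/
structure SmoothingState (a b : ℕ) where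
  iterate : JointMat a b
  dual : JointMat a b
  gradSum : JointMat a b

namespace QuantumGame

variable {a b : ℕ} {Ω : Type*} [Fintype Ω] (G : QuantumGame a b Ω)

/-- The maximizer in the definition of the smoothed duality gap
`max_{z'} {payoff α β' - payoff α' β - μ r(z')}` at the point `z = (α, β)`. -/
def smoothedMaximizer (zref : JointMat a b) (μ : ℝ) (z : JointMat a b) : JointMat a b :=
  argmaxOn (fun z' => G.payoff z.1 z'.2 - G.payoff z'.1 z.2 - μ * regularizer zref z')
    (jointStates a b)

/-- The gradient of the smoothed duality gap. -/
def smoothedGrad (zref : JointMat a b) (μ : ℝ) (z : JointMat a b) : JointMat a b :=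
  G.grad (G.smoothedMaximizer zref μ z)

/-- The smoothing parameter `μ = e / (2 D)` for the target accuracy `e`. -/
def smoothingParam (zref : JointMat a b) (e : ℝ) : ℝ := e / (2 * regMax zref)

/-- The Lipschitz constant `‖F‖² / μ` of the gradient of the smoothed duality gap. -/
def lipConst (zref : JointMat a b) (e : ℝ) : ℝ := G.opNorm ^ 2 / smoothingParam zref e

/-- One first-order iteration, number `k = 0, 1, …`, of Nesterov's accelerated method on the
smoothed duality gap for the target accuracy `e`, when started at `z₀`. With
`u = 2/(k+2) w + k/(k+2) z` and `g` the gradient at `u`, the new iterate minimizes the quadratic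
upper model `⟨g, y - u⟩ + L/2 ‖y - u‖²` over the joint states, and the new dual-averaging point
minimizes `∑_{i ≤ k} (i+1)/2 ⟨gᵢ, y⟩ + L/2 ‖y - z₀‖²`. -/
def smoothingStep (zref : JointMat a b) (e : ℝ) (z₀ : JointMat a b) (k : ℕ)
    (s : SmoothingState a b) : SmoothingState a b :=
  let u : JointMat a b := (2 / ((k : ℝ) + 2)) • s.dual + ((k : ℝ) / ((k : ℝ) + 2)) • s.iterate
  let g : JointMat a b := G.smoothedGrad zref (smoothingParam zref e) u
  let gs : JointMat a b := s.gradSum + (((k : ℝ) + 1) / 2) • g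
  let L : ℝ := G.lipConst zref e
  { iterate := argminOn (fun y => jointInner g (y - u) + L / 2 * jointNorm (y - u) ^ 2)
      (jointStates a b)
    dual := argminOn (fun y => jointInner gs y + L / 2 * jointNorm (y - z₀) ^ 2)
      (jointStates a b)
    gradSum := gs }

/-- The state of the smoothing procedure after `k` iterations. -/
def smoothingState (zref : JointMat a b) (e : ℝ) (z₀ : JointMat a b) : ℕ → SmoothingState a b
  | 0 => { iterate := z₀, dual := z₀, gradSum := 0 }
  | k + 1 => G.smoothingStep zref e z₀ k (smoothingState zref e z₀ k)

/-- The smoothing procedure with target accuracy `e`, started at `z₀`, stops after exactly `k`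
iterations and returns `z`: it stops after the first iteration whose iterate has duality gap at
most `e`. -/
def SmoothingReturns (zref : JointMat a b) (e : ℝ) (z₀ : JointMat a b) (k : ℕ)
    (z : JointMat a b) : Prop :=
  1 ≤ k ∧ z = (G.smoothingState zref e z₀ k).iterate ∧ G.gap z ≤ e ∧
    ∀ j, 1 ≤ j → j < k → e < G.gap (G.smoothingState zref e z₀ j).iterate

/-- The outer loop: from the current point `z` and the current accuracy `e`, it stops after a total
of `n` further first-order iterations and returns `out`. It stops as soon as the duality gap is at
most `ε`; otherwise it divides the accuracy by `γ` and restarts the smoothing procedure at the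
current point. -/
inductive OuterLoop (zref : JointMat a b) (γ ε : ℝ) :
    JointMat a b → ℝ → ℕ → JointMat a b → Prop
  | halt {z : JointMat a b} {e : ℝ} (h : G.gap z ≤ ε) : OuterLoop zref γ ε z e 0 z
  | restart {z z' out : JointMat a b} {e : ℝ} {k n : ℕ} (h : ε < G.gap z)
      (hcall : G.SmoothingReturns zref (e / γ) z k z')
      (hrest : OuterLoop zref γ ε z' (e / γ) n out) : OuterLoop zref γ ε z e (k + n) out

/-- `IterSmooth` with decay factor `γ` and target `ε`, started at `z₀` with initial accuracy
`gap z₀`, terminates after a total of `n` first-order iterations and returns `out`. -/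
def IterSmooth (zref : JointMat a b) (γ ε : ℝ) (z₀ : JointMat a b) (n : ℕ)
    (out : JointMat a b) : Prop :=
  G.OuterLoop zref γ ε z₀ (G.gap z₀) n out

end QuantumGame

end

/-! By Sion's minimax theorem the duality gap has minimum `0` on the joint states. Subtracting `μ r`
inside the maximum that defines it gives a function within `μ D_max = e / 2` of the gap whose
gradient is `‖F‖² / μ`-Lipschitz, so Nesterov's estimate sequence bounds its value after `k` steps
by a multiple of `‖F‖² dist(z₀)² / (μ k²)`. Each restart begins with `gap z₀ ≤ γ e`, hence with
`dist z₀ ≤ γ e / δ` by the error bound: the accuracy `e` cancels, all calls of the smoothing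
procedure obey the same iteration bound, and their number is logarithmic. -/

section StrongConvexity

variable {E : Type*} [NormedAddCommGroup E]

open scoped Topology in
lemma add_sq_norm_sub_le_of_isMinOn [NormedSpace ℝ E] {K : Set E} {f : E → ℝ} {m : ℝ} {x y : E}
    (hf : StrongConvexOn K m f) (hx : x ∈ K) (hmin : IsMinOn f K x) (hy : y ∈ K) :
    f x + m / 2 * ‖y - x‖ ^ 2 ≤ f y := by
  have hseg : ∀ᶠ t : ℝ in 𝓝[>] 0, (1 - t) * (m / 2 * ‖y - x‖ ^ 2) ≤ f y - f x := by
    filter_upwards [Ioo_mem_nhdsGT zero_lt_one] with t ⟨h0, h1⟩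
    have h := hmin (hf.1 hx hy (sub_nonneg.2 h1.le) h0.le (sub_add_cancel 1 t))
    have hc := hf.2 hx hy (sub_nonneg.2 h1.le) h0.le (sub_add_cancel 1 t)
    rw [norm_sub_rev x y] at hc
    simp only [Set.mem_ofPred_eq, smul_eq_mul] at h hc
    refine le_of_mul_le_mul_left ?_ h0
    linarith
  have hlim : Filter.Tendsto (fun t : ℝ => (1 - t) * (m / 2 * ‖y - x‖ ^ 2)) (𝓝[>] 0)
      (𝓝 ((1 - 0) * (m / 2 * ‖y - x‖ ^ 2))) :=
    tendsto_nhdsWithin_of_tendsto_nhds (by fun_prop : Continuous _).continuousAt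
  linarith [le_of_tendsto hlim hseg]

variable [InnerProductSpace ℝ E] {K : Set E}

open scoped RealInnerProductSpace

lemma strongConvexOn_linear_add_sq (hK : Convex ℝ K) (ℓ : E →ₗ[ℝ] ℝ) (L : ℝ) (c : E) :
    StrongConvexOn K L fun y => ℓ y + L / 2 * ‖y - c‖ ^ 2 := by
  rw [strongConvexOn_iff_convex]
  refine (((ℓ - L • innerₛₗ ℝ c).convexOn hK).add_const (L / 2 * ‖c‖ ^ 2)).congr fun y _ => ?_
  simp only [norm_sub_sq_real, LinearMap.sub_apply, LinearMap.smul_apply, innerₛₗ_apply_apply,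
    smul_eq_mul, real_inner_comm y c, Pi.add_apply]
  ring

lemma prox_three_point (hK : Convex ℝ K) (ℓ : E →ₗ[ℝ] ℝ) {L : ℝ} {c x y : E} (hx : x ∈ K)
    (hmin : IsMinOn (fun y => ℓ y + L / 2 * ‖y - c‖ ^ 2) K x) (hy : y ∈ K) :
    ℓ x + L / 2 * ‖x - c‖ ^ 2 + L / 2 * ‖y - x‖ ^ 2 ≤ ℓ y + L / 2 * ‖y - c‖ ^ 2 :=
  add_sq_norm_sub_le_of_isMinOn (strongConvexOn_linear_add_sq hK ℓ L c) hx hmin hy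

lemma mul_mul_le_sq_add_sq {M μ s t : ℝ} (hμ : 0 < μ) :
    M * s * t ≤ μ / 2 * s ^ 2 + M ^ 2 / μ / 2 * t ^ 2 := by
  have h : μ / 2 * s ^ 2 + M ^ 2 / μ / 2 * t ^ 2 - M * s * t = (μ * s - M * t) ^ 2 / (2 * μ) := by
    field_simp
    ring
  linarith [div_nonneg (sq_nonneg (μ * s - M * t)) (by positivity : 0 ≤ 2 * μ)]

/-- Nesterov's smoothing: a maximum of affine functions becomes smooth, with constant `M² / μ`,
once a `μ`-strongly convex regularizer is subtracted inside the maximum. -/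
lemma smoothed_max_quadratic_upper_bound (hK : Convex ℝ K) (B : E →ₗ[ℝ] E →ₗ[ℝ] ℝ)
    {M μ : ℝ} {c p q u y : E} (hμ : 0 < μ) (hp : p ∈ K)
    (hmax : IsMaxOn (fun w => B w u - μ * (‖w - c‖ ^ 2 / 2)) K p) (hq : q ∈ K)
    (hB : B (q - p) (y - u) ≤ M * ‖q - p‖ * ‖y - u‖) :
    B q y - μ * (‖q - c‖ ^ 2 / 2) ≤
      B p u - μ * (‖p - c‖ ^ 2 / 2) + B p (y - u) + M ^ 2 / μ / 2 * ‖y - u‖ ^ 2 := by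
  have hmin : IsMinOn (fun w => (-B.flip u) w + μ / 2 * ‖w - c‖ ^ 2) K p := by
    intro w hw
    have h := hmax hw
    simp only [Set.mem_ofPred_eq, LinearMap.neg_apply, LinearMap.flip_apply] at h ⊢
    linarith
  have hgrow := prox_three_point hK _ hp hmin hq
  have hamgm := mul_mul_le_sq_add_sq (M := M) (s := ‖q - p‖) (t := ‖y - u‖) hμ
  simp only [map_sub, LinearMap.sub_apply, LinearMap.neg_apply, LinearMap.flip_apply] at hB hgrow ⊢
  linarith

end StrongConvexity

section Acceleration

open scoped RealInnerProductSpace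

variable {E : Type*} [NormedAddCommGroup E] [InnerProductSpace ℝ E] {K : Set E} {f : E → ℝ}
  {L A : ℝ} {x₀ z w s g z' w' : E}

/-- The estimate-sequence invariant of Nesterov's accelerated dual-averaging scheme for minimizing
`f` over `K`, started at `x₀`: `A` is the accumulated weight, `z` the current iterate, `w` the
dual-averaging point and `s` the weighted sum of the gradients seen so far. -/
structure NesterovInvariant (K : Set E) (f : E → ℝ) (L : ℝ) (x₀ : E) (A : ℝ) (z w s : E) :
    Prop where
  iterate_mem : z ∈ K
  dual_mem : w ∈ K
  estimate : ∀ x ∈ K, ∀ y ∈ K,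
    A * f z + L / 2 * ‖x - w‖ ^ 2 + ⟪s, y - x⟫ ≤ L / 2 * ‖x - x₀‖ ^ 2 + A * f y

namespace NesterovInvariant

lemma zero (hx₀ : x₀ ∈ K) : NesterovInvariant K f L x₀ 0 x₀ x₀ 0 where
  iterate_mem := hx₀
  dual_mem := hx₀
  estimate _ _ _ _ := by simp

lemma weight_mul_sub_le (h : NesterovInvariant K f L x₀ A z w s) (hL : 0 ≤ L) {y : E}
    (hy : y ∈ K) : A * (f z - f y) ≤ L / 2 * ‖y - x₀‖ ^ 2 := by
  have := h.estimate y hy y hy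
  rw [sub_self, inner_zero_right] at this
  nlinarith [mul_nonneg hL (sq_nonneg ‖y - w‖)]

end NesterovInvariant

/-- One accelerated step, tested at the point `(1 - θ) z + θ x`, whose offset from `u` is
`θ (x - w)`. -/
lemma accelerated_descent (hK : Convex ℝ K) {θ : ℝ} (hθ₀ : 0 ≤ θ) (hθ₁ : θ ≤ 1) {x u : E}
    (hx : x ∈ K) (hz : z ∈ K) (hu : u = θ • w + (1 - θ) • z) (hlow : f u + ⟪g, z - u⟫ ≤ f z)
    (hup : f z' ≤ f u + ⟪g, z' - u⟫ + L / 2 * ‖z' - u‖ ^ 2)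
    (hmin : IsMinOn (fun y => ⟪g, y - u⟫ + L / 2 * ‖y - u‖ ^ 2) K z') :
    f z' ≤ (1 - θ) * f z + θ * (f u + ⟪g, x - u⟫) + θ ^ 2 * (L / 2 * ‖x - w‖ ^ 2) := by
  have hmodel := hmin (hK hz hx (sub_nonneg.2 hθ₁) hθ₀ (sub_add_cancel 1 θ))
  have hnorm : (1 - θ) • z + θ • x - u = θ • (x - w) := by rw [hu]; module
  have hinner : (1 - θ) • z + θ • x - u = (1 - θ) • (z - u) + θ • (x - u) := by module
  have hsq : ‖(1 - θ) • z + θ • x - u‖ ^ 2 = θ ^ 2 * ‖x - w‖ ^ 2 := by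
    rw [hnorm, norm_smul, mul_pow, Real.norm_eq_abs, sq_abs]
  simp only [Set.mem_ofPred_eq, hsq] at hmodel
  rw [hinner, inner_add_right, real_inner_smul_right, real_inner_smul_right] at hmodel
  linarith [mul_le_mul_of_nonneg_left hlow (sub_nonneg.2 hθ₁)]

lemma NesterovInvariant.step (hK : Convex ℝ K) (hL : 0 ≤ L) {θ W α : ℝ} (hθ₀ : 0 ≤ θ)
    (hθ₁ : θ ≤ 1) (hW : 0 ≤ W) (hθW : W * θ ^ 2 ≤ 1) (hA : (1 - θ) * W = A) (hα : θ * W = α)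
    {u : E} (h : NesterovInvariant K f L x₀ A z w s) (hu : u = θ • w + (1 - θ) • z)
    (hlow : ∀ y ∈ K, f u + ⟪g, y - u⟫ ≤ f y)
    (hup : f z' ≤ f u + ⟪g, z' - u⟫ + L / 2 * ‖z' - u‖ ^ 2)
    (hz' : z' ∈ K) (hz'min : IsMinOn (fun y => ⟪g, y - u⟫ + L / 2 * ‖y - u‖ ^ 2) K z')
    (hw' : w' ∈ K)
    (hw'min : IsMinOn (fun y => ⟪s + α • g, y⟫ + L / 2 * ‖y - x₀‖ ^ 2) K w') :
    NesterovInvariant K f L x₀ W z' w' (s + α • g) where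
  iterate_mem := hz'
  dual_mem := hw'
  estimate x hx y hy := by
    subst hA hα
    have hdescent := mul_le_mul_of_nonneg_left (accelerated_descent hK hθ₀ hθ₁ hw' h.iterate_mem hu
      (hlow z h.iterate_mem) hup hz'min) hW
    have hweight : W * θ ^ 2 * (L / 2 * ‖w' - w‖ ^ 2) ≤ L / 2 * ‖w' - w‖ ^ 2 :=
      mul_le_of_le_one_left (by positivity) hθW
    have hprev := h.estimate w' hw' y hy
    have hgrow := prox_three_point hK (innerₛₗ ℝ (s + (θ * W) • g)) hw' hw'min hx
    have hlin := mul_le_mul_of_nonneg_left (hlow y hy) (mul_nonneg hθ₀ hW)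
    simp only [innerₛₗ_apply_apply, inner_add_left, real_inner_smul_left, inner_sub_right]
      at hdescent hprev hgrow hlin ⊢
    linarith

end Acceleration

section HilbertSchmidt

variable {d a b : ℕ}

lemma hsInner_add_left (A B C : QMat d) : hsInner (A + B) C = hsInner A C + hsInner B C := by
  simp [hsInner, add_mul]

lemma hsInner_smul_left (t : ℝ) (A B : QMat d) : hsInner (t • A) B = t * hsInner A B := by
  simp [hsInner, Matrix.conjTranspose_smul]

lemma hsInner_comm (A B : QMat d) : hsInner A B = hsInner B A := by
  have h : (A.conjTranspose * B).trace = star (B.conjTranspose * A).trace := by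
    rw [← Matrix.trace_conjTranspose, Matrix.conjTranspose_mul, Matrix.conjTranspose_conjTranspose]
  simp [hsInner, h]

lemma hsInner_self (A : QMat d) : hsInner A A = ∑ i, ∑ j, ‖A i j‖ ^ 2 := by
  rw [Finset.sum_comm]
  simp only [hsInner, Matrix.trace, Matrix.diag, Matrix.mul_apply, Matrix.conjTranspose_apply,
    Complex.re_sum]
  refine Finset.sum_congr rfl fun i _ => Finset.sum_congr rfl fun j _ => ?_
  rw [Complex.star_def, Complex.conj_mul']
  norm_cast

lemma hsInner_self_nonneg (A : QMat d) : 0 ≤ hsInner A A := by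
  rw [hsInner_self]; positivity

lemma norm_apply_sq_le_hsInner_self (A : QMat d) (i j : Fin (2 ^ d)) :
    ‖A i j‖ ^ 2 ≤ hsInner A A := by
  rw [hsInner_self]
  exact (Finset.single_le_sum (f := fun j => ‖A i j‖ ^ 2) (fun _ _ => by positivity)
    (Finset.mem_univ j)).trans (Finset.single_le_sum (f := fun i => ∑ j, ‖A i j‖ ^ 2)
      (fun _ _ => by positivity) (Finset.mem_univ i))

lemma eq_zero_of_hsInner_self_eq_zero {A : QMat d} (h : hsInner A A = 0) : A = 0 := by
  ext i j
  simpa [h] using norm_apply_sq_le_hsInner_self A i j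

lemma isCompact_hsBall (d : ℕ) : IsCompact {A : QMat d | hsInner A A ≤ 1} := by
  have h : IsCompact (Set.univ.pi fun _ : Fin (2 ^ d) => Set.univ.pi fun _ : Fin (2 ^ d) =>
      Metric.closedBall (0 : ℂ) 1) :=
    isCompact_univ_pi fun _ => isCompact_univ_pi fun _ => isCompact_closedBall _ _
  refine h.of_isClosed_subset (isClosed_le (by simp only [hsInner]; fun_prop) continuous_const)
    fun A hA i _ j _ => ?_
  rw [mem_closedBall_zero_iff]
  exact (sq_le_one_iff₀ (norm_nonneg _)).1 ((norm_apply_sq_le_hsInner_self A i j).trans hA)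

lemma continuous_jointInner_self (a b : ℕ) :
    Continuous fun z : JointMat a b => jointInner z z := by
  simp only [jointInner, hsInner]
  fun_prop

lemma isVonNBounded_jointInner_self_lt_one (a b : ℕ) :
    Bornology.IsVonNBounded ℝ {z : JointMat a b | jointInner z z < 1} := by
  refine (((isCompact_hsBall a).prod (isCompact_hsBall b)).isVonNBounded ℝ).subset fun z hz => ?_
  have h₁ := hsInner_self_nonneg z.1
  have h₂ := hsInner_self_nonneg z.2
  rw [Set.mem_ofPred_eq, jointInner] at hz
  constructor <;> rw [Set.mem_ofPred_eq] <;> linarith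

/-- The Hilbert-Schmidt inner product on pairs of matrices satisfies the axioms of a real inner
product. -/
@[reducible] def jointInnerCore (a b : ℕ) : InnerProductSpace.Core ℝ (JointMat a b) where
  inner := jointInner
  conj_inner_symm z w := by simp [jointInner, hsInner_comm w.1, hsInner_comm w.2]
  re_inner_nonneg z := add_nonneg (hsInner_self_nonneg z.1) (hsInner_self_nonneg z.2)
  add_left x y z := by simp only [jointInner, Prod.fst_add, Prod.snd_add, hsInner_add_left]; ring
  smul_left x y t := by
    simp only [jointInner, Prod.smul_fst, Prod.smul_snd, hsInner_smul_left]
    simp [mul_add]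
  definite z hz := by
    have h₁ := hsInner_self_nonneg z.1
    have h₂ := hsInner_self_nonneg z.2
    rw [jointInner] at hz
    exact Prod.ext (eq_zero_of_hsInner_self_eq_zero (by linarith))
      (eq_zero_of_hsInner_self_eq_zero (by linarith))

/-- The Frobenius norm on pairs of matrices, inducing the entrywise topology. -/
@[reducible] noncomputable def jointNormedAddCommGroup (a b : ℕ) :
    NormedAddCommGroup (JointMat a b) :=
  (jointInnerCore a b).toNormedAddCommGroupOfTopology (continuous_jointInner_self a b).continuousAt
    (isVonNBounded_jointInner_self_lt_one a b)

attribute [local instance] jointNormedAddCommGroup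

/-- Pairs of matrices as a real Hilbert space with the Hilbert-Schmidt inner product. -/
@[reducible] noncomputable def jointInnerProductSpace (a b : ℕ) :
    InnerProductSpace ℝ (JointMat a b) :=
  .ofCoreOfTopology (jointInnerCore a b) (continuous_jointInner_self a b).continuousAt
    (isVonNBounded_jointInner_self_lt_one a b)

attribute [local instance] jointInnerProductSpace

open scoped RealInnerProductSpace in
lemma jointInner_eq_inner (z w : JointMat a b) : jointInner z w = ⟪z, w⟫ := rfl

end HilbertSchmidt

attribute [local instance] jointNormedAddCommGroup jointInnerProductSpace

open scoped RealInnerProductSpace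

section Spectraplex

variable {d a b : ℕ}

lemma convex_spectraplex (d : ℕ) : Convex ℝ (spectraplex d) := by
  rintro A ⟨hA, hA'⟩ B ⟨hB, hB'⟩ s t hs ht hst
  refine ⟨(hA.smul hs).add (hB.smul ht), ?_⟩
  rw [Matrix.trace_add, Matrix.trace_smul, Matrix.trace_smul, hA', hB']
  simp only [Complex.real_smul, mul_one]
  exact_mod_cast hst

/-- Nonnegativity of the `2 × 2` principal minors. -/
lemma norm_apply_sq_le_mul_diag {ι : Type*} {A : Matrix ι ι ℂ} (hA : A.PosSemidef) (i j : ι) :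
    ‖A i j‖ ^ 2 ≤ (A i i).re * (A j j).re := by
  have hdet := (hA.submatrix ![i, j]).det_nonneg
  have hi : (A i i) = ((A i i).re : ℂ) :=
    (Complex.conj_eq_iff_re.1 (hA.isHermitian.apply i i)).symm
  have hj : (A j j) = ((A j j).re : ℂ) :=
    (Complex.conj_eq_iff_re.1 (hA.isHermitian.apply j j)).symm
  rw [Matrix.det_fin_two] at hdet
  simp only [Matrix.submatrix_apply, Matrix.cons_val_zero, Matrix.cons_val_one] at hdet
  rw [← hA.isHermitian.apply j i, Complex.star_def, Complex.mul_conj', hi, hj] at hdet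
  exact sub_nonneg.1 (by exact_mod_cast hdet)

lemma hsInner_self_le_one {A : QMat d} (hA : A ∈ spectraplex d) : hsInner A A ≤ 1 := by
  have htrace : ∑ i, (A i i).re = 1 := by
    simpa [Matrix.trace, Complex.re_sum] using congrArg Complex.re hA.2
  rw [hsInner_self]
  calc ∑ i, ∑ j, ‖A i j‖ ^ 2 ≤ ∑ i, ∑ j, (A i i).re * (A j j).re :=
        Finset.sum_le_sum fun i _ => Finset.sum_le_sum fun j _ =>
          norm_apply_sq_le_mul_diag hA.1 i j
    _ = 1 := by rw [← Finset.sum_mul_sum, htrace, one_mul]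

lemma isClosed_spectraplex (d : ℕ) : IsClosed (spectraplex d) := by
  have h : spectraplex d = {A | A.conjTranspose = A} ∩
      (⋂ x : Fin (2 ^ d) → ℂ, {A | 0 ≤ star x ⬝ᵥ A.mulVec x}) ∩ {A | A.trace = 1} := by
    ext A
    simp [spectraplex, Matrix.posSemidef_iff_dotProduct_mulVec, Matrix.IsHermitian]
  rw [h]
  exact ((isClosed_eq (by fun_prop) (by fun_prop)).inter
    (isClosed_iInter fun x => isClosed_le continuous_const (by fun_prop))).inter
    (isClosed_eq (by fun_prop) (by fun_prop))

lemma isCompact_spectraplex (d : ℕ) : IsCompact (spectraplex d) :=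
  (isCompact_hsBall d).of_isClosed_subset (isClosed_spectraplex d) fun _ => hsInner_self_le_one

lemma spectraplex_nonempty (d : ℕ) : (spectraplex d).Nonempty := by
  refine ⟨((2 : ℝ) ^ d)⁻¹ • 1, Matrix.PosSemidef.one.smul (by positivity), ?_⟩
  rw [Matrix.trace_smul, Matrix.trace_one]
  simp

lemma convex_jointStates (a b : ℕ) : Convex ℝ (jointStates a b) :=
  (convex_spectraplex a).prod (convex_spectraplex b)

lemma jointStates_nonempty (a b : ℕ) : (jointStates a b).Nonempty :=
  (spectraplex_nonempty a).prod (spectraplex_nonempty b)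

lemma isCompact_jointStates (a b : ℕ) : IsCompact (jointStates a b) :=
  (isCompact_spectraplex a).prod (isCompact_spectraplex b)

lemma norm_le_sqrt_two {z : JointMat a b} (hz : z ∈ jointStates a b) : ‖z‖ ≤ √2 :=
  Real.sqrt_le_sqrt <|
    (add_le_add (hsInner_self_le_one hz.1) (hsInner_self_le_one hz.2)).trans_eq one_add_one_eq_two

lemma ne_zero_of_mem_jointStates {z : JointMat a b} (hz : z ∈ jointStates a b) : z ≠ 0 := by
  rintro rfl
  simpa using hz.1.2

/-- Pairs of Hermitian matrices as a real subspace. -/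
noncomputable def jointHermitianSubmodule (a b : ℕ) : Submodule ℝ (JointMat a b) :=
  (selfAdjoint.submodule ℝ (QMat a)).prod (selfAdjoint.submodule ℝ (QMat b))

lemma jointStates_subset_jointHermitian (a b : ℕ) : jointStates a b ⊆ jointHermitian a b :=
  fun _ hz => ⟨hz.1.1.isHermitian, hz.2.1.isHermitian⟩

lemma sub_mem_jointHermitian {z w : JointMat a b} (hz : z ∈ jointStates a b)
    (hw : w ∈ jointStates a b) : z - w ∈ jointHermitian a b :=
  (jointHermitianSubmodule a b).sub_mem (jointStates_subset_jointHermitian a b hz)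
    (jointStates_subset_jointHermitian a b hw)

end Spectraplex

section PartialTrace

variable {R m n : Type*} [CommSemiring R] [Fintype m] [Fintype n]

lemma trace_mul_kronecker_one [DecidableEq n] (M : Matrix (m × n) (m × n) R) (A : Matrix m m R) :
    (M * (A ⊗ₖ (1 : Matrix n n R))).trace =
      (Matrix.of (fun i j => ∑ k, M (i, k) (j, k)) * A).trace := by
  simp only [Matrix.trace, Matrix.diag, Matrix.mul_apply, Matrix.of_apply,
    Matrix.kroneckerMap_apply, Fintype.sum_prod_type, Matrix.one_apply, mul_ite, mul_one, mul_zero,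
    Finset.sum_ite_eq', Finset.mem_univ, if_true, Finset.sum_mul]
  exact Finset.sum_congr rfl fun i _ => Finset.sum_comm

lemma trace_mul_one_kronecker [DecidableEq m] (M : Matrix (m × n) (m × n) R) (B : Matrix n n R) :
    (M * ((1 : Matrix m m R) ⊗ₖ B)).trace =
      (Matrix.of (fun i j => ∑ k, M (k, i) (k, j)) * B).trace := by
  simp only [Matrix.trace, Matrix.diag, Matrix.mul_apply, Matrix.of_apply,
    Matrix.kroneckerMap_apply, Fintype.sum_prod_type, Matrix.one_apply, ite_mul, one_mul, zero_mul,
    mul_ite, mul_zero, Finset.sum_ite_irrel, Finset.sum_const_zero, Finset.sum_ite_eq',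
    Finset.mem_univ, if_true, Finset.sum_mul]
  rw [Finset.sum_comm]
  exact Finset.sum_congr rfl fun k _ => Finset.sum_comm

end PartialTrace

namespace QuantumGame

section Saddle

variable {a b : ℕ} {Ω : Type*} [Fintype Ω] (G : QuantumGame a b Ω)

/-- The expected payoff as a real bilinear form in the two states. -/
noncomputable def payoffForm : QMat a →ₗ[ℝ] QMat b →ₗ[ℝ] ℝ :=
  LinearMap.mk₂ ℝ G.payoff
    (fun α α' β => by simp [payoff, Matrix.add_kronecker, mul_add])
    (fun t α β => by simp [payoff, Matrix.smul_kronecker])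
    (fun α β β' => by simp [payoff, Matrix.kronecker_add, mul_add])
    (fun t α β => by simp [payoff, Matrix.kronecker_smul])

/-- The skew-symmetric form `payoff α β' - payoff α' β` in `(α', β')` and `(α, β)`, whose maximum
over the first argument is the duality gap. -/
noncomputable def saddleForm : JointMat a b →ₗ[ℝ] JointMat a b →ₗ[ℝ] ℝ :=
  let P := G.payoffForm.compl₁₂ (LinearMap.fst ℝ _ _) (LinearMap.snd ℝ _ _)
  P.flip - P

lemma saddleForm_apply (w z : JointMat a b) :
    G.saddleForm w z = G.payoff z.1 w.2 - G.payoff w.1 z.2 := rfl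

lemma saddleForm_self (z : JointMat a b) : G.saddleForm z z = 0 := sub_self _

lemma trace_superop_mul (α : QMat a) (β : QMat b) :
    (G.superop β * α).trace = (G.observable.conjTranspose * (α ⊗ₖ β)).trace := by
  rw [superop, ← trace_mul_kronecker_one, Matrix.mul_assoc, ← Matrix.mul_kronecker_mul, one_mul,
    mul_one]

lemma trace_superopAdj_mul (α : QMat a) (β : QMat b) :
    (G.superopAdj α * β).trace = (G.observable.conjTranspose * (α ⊗ₖ β)).trace := by
  rw [superopAdj, ← trace_mul_one_kronecker, Matrix.mul_assoc, ← Matrix.mul_kronecker_mul, one_mul,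
    mul_one]

lemma inner_grad (w : JointMat a b) {z : JointMat a b} (hz : z ∈ jointHermitian a b) :
    ⟪G.grad w, z⟫ = G.saddleForm w z := by
  have hs {d : ℕ} (A : QMat d) {B : QMat d} (hB : B.IsHermitian) :
      hsInner A B = (A * B).trace.re := by
    rw [hsInner_comm, hsInner, hB, Matrix.trace_mul_comm]
  rw [← jointInner_eq_inner, jointInner, hs _ hz.1, hs _ hz.2, grad, trace_superop_mul, neg_mul,
    Matrix.trace_neg, trace_superopAdj_mul, Complex.neg_re, saddleForm_apply, payoff, payoff,
    sub_eq_add_neg]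

lemma continuous_payoff {X : Type*} [TopologicalSpace X] {f : X → QMat a} {g : X → QMat b}
    (hf : Continuous f) (hg : Continuous g) : Continuous fun x => G.payoff (f x) (g x) := by
  simp only [payoff]
  refine Complex.continuous_re.comp (Continuous.matrix_trace (continuous_const.matrix_mul ?_))
  refine continuous_matrix fun i j => ?_
  simp only [Matrix.kroneckerMap_apply]
  exact (hf.matrix_elem _ _).mul (hg.matrix_elem _ _)

lemma continuous_saddleForm {X : Type*} [TopologicalSpace X] {f g : X → JointMat a b}
    (hf : Continuous f) (hg : Continuous g) : Continuous fun x => G.saddleForm (f x) (g x) :=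
  (G.continuous_payoff hg.fst hf.snd).sub (G.continuous_payoff hf.fst hg.snd)

lemma bddAbove_opNorm : BddAbove {t | ∃ z ∈ jointHermitian a b, ∃ w ∈ jointHermitian a b,
    jointNorm z = 1 ∧ jointNorm w = 1 ∧ t = jointInner (G.grad z) w} := by
  have h := ((isCompact_sphere (0 : JointMat a b) 1).prod (isCompact_sphere 0 1)).bddAbove_image
    (G.continuous_saddleForm continuous_fst continuous_snd).continuousOn
  refine h.mono ?_
  rintro t ⟨z, -, w, hw, hz1, hw1, rfl⟩
  exact ⟨(z, w), ⟨mem_sphere_zero_iff_norm.2 hz1, mem_sphere_zero_iff_norm.2 hw1⟩,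
    (G.inner_grad z hw).symm⟩

lemma saddleForm_le {z w : JointMat a b} (hw : w ∈ jointHermitian a b)
    (hz : z ∈ jointHermitian a b) : G.saddleForm w z ≤ G.opNorm * ‖w‖ * ‖z‖ := by
  rcases eq_or_ne w 0 with rfl | hw0
  · simp
  rcases eq_or_ne z 0 with rfl | hz0
  · simp
  have hw' := (jointHermitianSubmodule a b).smul_mem ‖w‖⁻¹ hw
  have hz' := (jointHermitianSubmodule a b).smul_mem ‖z‖⁻¹ hz
  have h : ⟪G.grad (‖w‖⁻¹ • w), ‖z‖⁻¹ • z⟫ ≤ G.opNorm :=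
    le_csSup G.bddAbove_opNorm ⟨_, hw', _, hz', norm_smul_inv_norm (𝕜 := ℝ) hw0,
      norm_smul_inv_norm (𝕜 := ℝ) hz0, rfl⟩
  rw [inner_grad _ _ hz', map_smul, map_smul, LinearMap.smul_apply, smul_eq_mul, smul_eq_mul,
    inv_mul_le_iff₀ (norm_pos_iff.2 hz0), inv_mul_le_iff₀ (norm_pos_iff.2 hw0)] at h
  linarith

lemma opNorm_nonneg : 0 ≤ G.opNorm := by
  obtain ⟨z, hz⟩ := jointStates_nonempty a b
  have hz' := jointStates_subset_jointHermitian a b hz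
  have hpos : 0 < ‖z‖ := norm_pos_iff.2 (ne_zero_of_mem_jointStates hz)
  have h := G.saddleForm_le hz' hz'
  rw [saddleForm_self, mul_assoc] at h
  exact nonneg_of_mul_nonneg_left h (by positivity)

lemma isGreatest_gap (z : JointMat a b) :
    IsGreatest ((fun w => G.saddleForm w z) '' jointStates a b) (G.gap z) := by
  obtain ⟨β, hβ, hβ'⟩ := (isCompact_spectraplex b).exists_sSup_image_eq (spectraplex_nonempty b)
    (G.continuous_payoff (continuous_const (y := z.1)) continuous_id).continuousOn
  obtain ⟨α, hα, hα'⟩ := (isCompact_spectraplex a).exists_sInf_image_eq (spectraplex_nonempty a)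
    (G.continuous_payoff continuous_id (continuous_const (y := z.2))).continuousOn
  have hb := ((isCompact_spectraplex b).image
    (G.continuous_payoff (continuous_const (y := z.1)) continuous_id)).bddAbove
  have ha := ((isCompact_spectraplex a).image
    (G.continuous_payoff continuous_id (continuous_const (y := z.2)))).bddBelow
  refine ⟨⟨(α, β), ⟨hα, hβ⟩, ?_⟩, ?_⟩
  · exact congrArg₂ (· - ·) hβ'.symm hα'.symm
  · rintro _ ⟨w, hw, rfl⟩
    exact sub_le_sub (le_csSup hb ⟨w.2, hw.2, rfl⟩) (csInf_le ha ⟨w.1, hw.1, rfl⟩)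

lemma saddleForm_le_gap {w : JointMat a b} (hw : w ∈ jointStates a b) (z : JointMat a b) :
    G.saddleForm w z ≤ G.gap z := (G.isGreatest_gap z).2 ⟨w, hw, rfl⟩

lemma exists_gap_eq (z : JointMat a b) : ∃ w ∈ jointStates a b, G.gap z = G.saddleForm w z := by
  obtain ⟨w, hw, h⟩ := (G.isGreatest_gap z).1
  exact ⟨w, hw, h.symm⟩

lemma gap_nonneg {z : JointMat a b} (hz : z ∈ jointStates a b) : 0 ≤ G.gap z :=
  (G.saddleForm_self z).symm.trans_le (G.saddleForm_le_gap hz z)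

lemma continuous_gap : Continuous G.gap := by
  have h : G.gap = fun z => sSup ((fun w => G.saddleForm w z) '' jointStates a b) :=
    funext fun z => (G.isGreatest_gap z).csSup_eq.symm
  rw [h]
  exact (isCompact_jointStates a b).continuous_sSup (f := fun z w => G.saddleForm w z)
    (G.continuous_saddleForm continuous_snd continuous_fst)

lemma gap_le_two_mul_opNorm {z : JointMat a b} (hz : z ∈ jointStates a b) :
    G.gap z ≤ 2 * G.opNorm := by
  obtain ⟨w, hw, h⟩ := G.exists_gap_eq z
  calc G.gap z = G.saddleForm w z := h
    _ ≤ G.opNorm * ‖w‖ * ‖z‖ := G.saddleForm_le (jointStates_subset_jointHermitian a b hw)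
        (jointStates_subset_jointHermitian a b hz)
    _ ≤ G.opNorm * √2 * √2 := by
        have := G.opNorm_nonneg
        gcongr
        exacts [norm_le_sqrt_two hw, norm_le_sqrt_two hz]
    _ = 2 * G.opNorm := by rw [mul_assoc, Real.mul_self_sqrt zero_le_two, mul_comm]

lemma gap_sub_gap_le {z z' : JointMat a b} (hz : z ∈ jointStates a b)
    (hz' : z' ∈ jointStates a b) : G.gap z - G.gap z' ≤ √2 * G.opNorm * ‖z - z'‖ := by
  obtain ⟨w, hw, h⟩ := G.exists_gap_eq z
  calc G.gap z - G.gap z' ≤ G.saddleForm w z - G.saddleForm w z' := by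
        rw [h]; exact sub_le_sub_left (G.saddleForm_le_gap hw z') _
    _ = G.saddleForm w (z - z') := (map_sub _ _ _).symm
    _ ≤ G.opNorm * ‖w‖ * ‖z - z'‖ := G.saddleForm_le (jointStates_subset_jointHermitian a b hw)
        (sub_mem_jointHermitian hz hz')
    _ ≤ √2 * G.opNorm * ‖z - z'‖ := by
        rw [mul_comm (√2)]
        have := G.opNorm_nonneg
        gcongr
        exact norm_le_sqrt_two hw

lemma exists_gap_eq_zero : ∃ z ∈ jointStates a b, G.gap z = 0 := by
  obtain ⟨α, hα, β, hβ, hsaddle⟩ := Sion.exists_isSaddlePointOn (f := G.payoff)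
    (spectraplex_nonempty a) (convex_spectraplex a) (isCompact_spectraplex a)
    (fun β _ => (G.continuous_payoff continuous_id
      continuous_const).lowerSemicontinuous.lowerSemicontinuousOn _)
    (fun β _ => ((G.payoffForm.flip β).convexOn (convex_spectraplex a)).quasiconvexOn)
    (convex_spectraplex b) (spectraplex_nonempty b) (isCompact_spectraplex b)
    (fun α _ => (G.continuous_payoff continuous_const
      continuous_id).upperSemicontinuous.upperSemicontinuousOn _)
    (fun α _ => ((G.payoffForm α).concaveOn (convex_spectraplex b)).quasiconcaveOn)
  obtain ⟨w, hw, h⟩ := G.exists_gap_eq (α, β)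
  refine ⟨(α, β), ⟨hα, hβ⟩, (G.gap_nonneg ⟨hα, hβ⟩).antisymm' ?_⟩
  rw [h, saddleForm_apply, sub_nonpos]
  exact hsaddle w.1 hw.1 w.2 hw.2

end Saddle

end QuantumGame

lemma argminOn_spec {E : Type*} [TopologicalSpace E] [Nonempty E] {f : E → ℝ} {K : Set E}
    (hK : IsCompact K) (hne : K.Nonempty) (hf : ContinuousOn f K) :
    argminOn f K ∈ K ∧ IsMinOn f K (argminOn f K) :=
  Classical.epsilon_spec (hK.exists_isMinOn hne hf)

lemma argmaxOn_spec {E : Type*} [TopologicalSpace E] [Nonempty E] {f : E → ℝ} {K : Set E}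
    (hK : IsCompact K) (hne : K.Nonempty) (hf : ContinuousOn f K) :
    argmaxOn f K ∈ K ∧ IsMaxOn f K (argmaxOn f K) :=
  Classical.epsilon_spec (hK.exists_isMaxOn hne hf)

section Regularizer

variable {a b : ℕ} (zref : JointMat a b)

lemma regularizer_eq (z : JointMat a b) : regularizer zref z = ‖z - zref‖ ^ 2 / 2 := rfl

lemma continuous_regularizer : Continuous (regularizer zref) := by
  simp only [funext (regularizer_eq zref)]
  fun_prop

lemma regularizer_nonneg (z : JointMat a b) : 0 ≤ regularizer zref z := by
  rw [regularizer]; positivity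

lemma regularizer_le_regMax {z : JointMat a b} (hz : z ∈ jointStates a b) :
    regularizer zref z ≤ regMax zref :=
  le_csSup ((isCompact_jointStates a b).image (continuous_regularizer zref)).bddAbove ⟨z, hz, rfl⟩

lemma regMax_nonneg : 0 ≤ regMax zref :=
  Real.sSup_nonneg (by rintro _ ⟨z, -, rfl⟩; exact regularizer_nonneg zref z)

variable {zref}

lemma regMax_le_four (h : zref ∈ jointStates a b) : regMax zref ≤ 4 := by
  refine csSup_le ((jointStates_nonempty a b).image _) ?_
  rintro _ ⟨z, hz, rfl⟩
  have hdist : ‖z - zref‖ ≤ 2 * √2 :=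
    (norm_sub_le z zref).trans (by linarith [norm_le_sqrt_two hz, norm_le_sqrt_two h])
  calc ‖z - zref‖ ^ 2 / 2 ≤ (2 * √2) ^ 2 / 2 := by gcongr
    _ = 4 := by rw [mul_pow, Real.sq_sqrt zero_le_two]; norm_num

lemma eq_zref_of_regMax_eq_zero (h : regMax zref = 0) {z : JointMat a b}
    (hz : z ∈ jointStates a b) : z = zref := by
  have hsq := regularizer_le_regMax zref hz
  rw [h, regularizer_eq] at hsq
  have : ‖z - zref‖ ^ 2 = 0 := le_antisymm (by linarith) (sq_nonneg _)
  exact sub_eq_zero.1 (norm_eq_zero.1 (pow_eq_zero_iff two_ne_zero |>.1 this))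

end Regularizer

namespace QuantumGame

section Optimal

variable {a b : ℕ} {Ω : Type*} [Fintype Ω] (G : QuantumGame a b Ω)

lemma mem_opt_iff {z : JointMat a b} : z ∈ G.opt ↔ z ∈ jointStates a b ∧ G.gap z = 0 := by
  obtain ⟨z₀, hz₀, h₀⟩ := G.exists_gap_eq_zero
  refine ⟨fun h => ⟨h.1, ((h.2 hz₀).trans_eq h₀).antisymm (G.gap_nonneg h.1)⟩,
    fun h => ⟨h.1, fun y hy => ?_⟩⟩
  exact h.2.trans_le (G.gap_nonneg hy)

lemma exists_dist_eq (z : JointMat a b) : ∃ w ∈ G.opt, G.dist z = ‖z - w‖ := by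
  have hopt : G.opt = jointStates a b ∩ {z | G.gap z = 0} := Set.ext fun _ => G.mem_opt_iff
  have hcompact : IsCompact G.opt := hopt ▸
    (isCompact_jointStates a b).inter_right (isClosed_eq G.continuous_gap continuous_const)
  have hne : G.opt.Nonempty := G.exists_gap_eq_zero.imp fun _ => G.mem_opt_iff.2
  exact hcompact.exists_sInf_image_eq hne (by fun_prop : Continuous fun w => ‖z - w‖).continuousOn

lemma dist_nonneg (z : JointMat a b) : 0 ≤ G.dist z := by
  obtain ⟨w, -, h⟩ := G.exists_dist_eq z
  exact h ▸ norm_nonneg _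

lemma gap_le_mul_dist {z : JointMat a b} (hz : z ∈ jointStates a b) :
    G.gap z ≤ √2 * G.opNorm * G.dist z := by
  obtain ⟨w, hw, h⟩ := G.exists_dist_eq z
  have hgap := G.gap_sub_gap_le hz hw.1
  rwa [(G.mem_opt_iff.1 hw).2, sub_zero, ← h] at hgap

lemma modulus_mul_dist_le_gap {z : JointMat a b} (hz : z ∈ jointStates a b) :
    G.modulus * ENNReal.ofReal (G.dist z) ≤ ENNReal.ofReal (G.gap z) := by
  simp only [modulus, ENNReal.iSup_mul]
  refine iSup₂_le fun d hd => ?_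
  rw [← ENNReal.ofReal_mul hd.1.le, mul_comm]
  exact ENNReal.ofReal_le_ofReal ((le_div_iff₀ hd.1).1 (hd.2 z hz))

lemma modulus_le_of_gap_pos {z : JointMat a b} (hz : z ∈ jointStates a b) (hpos : 0 < G.gap z) :
    G.modulus ≤ ENNReal.ofReal (√2 * G.opNorm) := by
  have hgap := G.gap_le_mul_dist hz
  have hdist : 0 < G.dist z := (G.dist_nonneg z).lt_of_ne' fun h => by
    rw [h, mul_zero] at hgap; linarith
  refine iSup₂_le fun d hd => ENNReal.ofReal_le_ofReal ?_
  exact le_of_mul_le_mul_right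
    (((mul_comm d _).trans_le ((le_div_iff₀ hd.1).1 (hd.2 z hz))).trans hgap) hdist

lemma regMax_pos_of_gap_pos (zref : JointMat a b) {z : JointMat a b} (hz : z ∈ jointStates a b)
    (hpos : 0 < G.gap z) : 0 < regMax zref := by
  refine (regMax_nonneg zref).lt_of_ne' fun h => hpos.ne' ?_
  obtain ⟨w, hw, hgap⟩ := G.exists_gap_eq z
  rw [hgap, eq_zref_of_regMax_eq_zero h hw, eq_zref_of_regMax_eq_zero h hz, saddleForm_self]

end Optimal

section Smoothed

variable {a b : ℕ} {Ω : Type*} [Fintype Ω] (G : QuantumGame a b Ω) (zref : JointMat a b) (μ : ℝ)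

/-- The smoothed duality gap `max_{z'} {payoff α β' - payoff α' β - μ r(z')}`, written as the value
at a maximizer. -/
noncomputable def smoothedGap (z : JointMat a b) : ℝ :=
  G.saddleForm (G.smoothedMaximizer zref μ z) z -
    μ * regularizer zref (G.smoothedMaximizer zref μ z)

lemma smoothedMaximizer_spec (z : JointMat a b) :
    G.smoothedMaximizer zref μ z ∈ jointStates a b ∧
      IsMaxOn (fun w => G.saddleForm w z - μ * regularizer zref w) (jointStates a b)
        (G.smoothedMaximizer zref μ z) :=
  argmaxOn_spec (isCompact_jointStates a b) (jointStates_nonempty a b)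
    ((G.continuous_saddleForm continuous_id continuous_const).sub
      (continuous_const.mul (continuous_regularizer zref))).continuousOn

lemma saddleForm_sub_le_smoothedGap {w : JointMat a b} (hw : w ∈ jointStates a b)
    (z : JointMat a b) :
    G.saddleForm w z - μ * regularizer zref w ≤ G.smoothedGap zref μ z :=
  (G.smoothedMaximizer_spec zref μ z).2 hw

variable {zref μ} {u y : JointMat a b}

lemma inner_smoothedGrad_sub (hu : u ∈ jointStates a b) (hy : y ∈ jointStates a b) :
    ⟪G.smoothedGrad zref μ u, y - u⟫ = G.saddleForm (G.smoothedMaximizer zref μ u) (y - u) :=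
  G.inner_grad _ (sub_mem_jointHermitian hy hu)

lemma smoothedGap_linear_lower_bound (hu : u ∈ jointStates a b) (hy : y ∈ jointStates a b) :
    G.smoothedGap zref μ u + ⟪G.smoothedGrad zref μ u, y - u⟫ ≤ G.smoothedGap zref μ y := by
  have h := G.saddleForm_sub_le_smoothedGap zref μ (G.smoothedMaximizer_spec zref μ u).1 y
  rw [G.inner_smoothedGrad_sub hu hy, map_sub, smoothedGap]
  linarith

lemma smoothedGap_quadratic_upper_bound (hμ : 0 < μ) (hu : u ∈ jointStates a b)
    (hy : y ∈ jointStates a b) :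
    G.smoothedGap zref μ y ≤ G.smoothedGap zref μ u + ⟪G.smoothedGrad zref μ u, y - u⟫ +
      G.opNorm ^ 2 / μ / 2 * ‖y - u‖ ^ 2 := by
  obtain ⟨hp, hmax⟩ := G.smoothedMaximizer_spec zref μ u
  have hq := (G.smoothedMaximizer_spec zref μ y).1
  rw [G.inner_smoothedGrad_sub hu hy]
  exact smoothed_max_quadratic_upper_bound (convex_jointStates a b) G.saddleForm hμ hp hmax hq
    (G.saddleForm_le (sub_mem_jointHermitian hq hp) (sub_mem_jointHermitian hy hu))

lemma smoothedGap_le_gap (hμ : 0 ≤ μ) (z : JointMat a b) : G.smoothedGap zref μ z ≤ G.gap z :=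
  (sub_le_self _ (mul_nonneg hμ (regularizer_nonneg zref _))).trans
    (G.saddleForm_le_gap (G.smoothedMaximizer_spec zref μ z).1 z)

lemma gap_le_smoothedGap_add (hμ : 0 ≤ μ) (z : JointMat a b) :
    G.gap z ≤ G.smoothedGap zref μ z + μ * regMax zref := by
  obtain ⟨w, hw, h⟩ := G.exists_gap_eq z
  have hsmooth := G.saddleForm_sub_le_smoothedGap zref μ hw z
  have hreg := mul_le_mul_of_nonneg_left (regularizer_le_regMax zref hw) hμ
  linarith

end Smoothed

end QuantumGame

namespace QuantumGame

section Convergence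

variable {a b : ℕ} {Ω : Type*} [Fintype Ω] (G : QuantumGame a b Ω) {zref z₀ : JointMat a b} {e : ℝ}

lemma smoothingParam_pos (he : 0 < e) (hD : 0 < regMax zref) : 0 < smoothingParam zref e := by
  rw [smoothingParam]; positivity

lemma smoothingParam_mul_regMax (hD : regMax zref ≠ 0) :
    smoothingParam zref e * regMax zref = e / 2 := by
  rw [smoothingParam]; field_simp

lemma mul_lipConst (he : e ≠ 0) (hD : regMax zref ≠ 0) :
    e * G.lipConst zref e = 2 * G.opNorm ^ 2 * regMax zref := by
  rw [lipConst, smoothingParam]; field_simp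

lemma nesterovInvariant_smoothingState (he : 0 < e) (hD : 0 < regMax zref)
    (hz₀ : z₀ ∈ jointStates a b) (k : ℕ) :
    NesterovInvariant (jointStates a b) (G.smoothedGap zref (smoothingParam zref e))
      (G.lipConst zref e) z₀ (k * (k + 1) / 4) (G.smoothingState zref e z₀ k).iterate
      (G.smoothingState zref e z₀ k).dual (G.smoothingState zref e z₀ k).gradSum := by
  have hμ := smoothingParam_pos he hD
  induction k with
  | zero => simpa [smoothingState] using NesterovInvariant.zero hz₀
  | succ k ih =>
    have hθ : 1 - 2 / ((k : ℝ) + 2) = k / (k + 2) := by field_simp; ring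
    let s := G.smoothingState zref e z₀ k
    let u := (2 / ((k : ℝ) + 2)) • s.dual + ((k : ℝ) / (k + 2)) • s.iterate
    let g := G.smoothedGrad zref (smoothingParam zref e) u
    have hu : u ∈ jointStates a b := convex_jointStates a b ih.dual_mem ih.iterate_mem
      (by positivity) (by positivity) (by rw [← hθ, add_sub_cancel])
    have hprox (ℓ : JointMat a b → ℝ) (hℓ : Continuous ℓ) (c : JointMat a b) :=
      argminOn_spec (isCompact_jointStates a b) (jointStates_nonempty a b)
        (by fun_prop : Continuous fun y => ℓ y + G.lipConst zref e / 2 * ‖y - c‖ ^ 2).continuousOn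
    have hz' := hprox (fun y => ⟪g, y - u⟫) (by fun_prop) u
    have hw' := hprox (fun y => ⟪s.gradSum + (((k : ℝ) + 1) / 2) • g, y⟫) (by fun_prop) z₀
    refine ih.step (convex_jointStates a b) (θ := 2 / (k + 2)) (div_nonneg (sq_nonneg _) hμ.le)
      (by positivity) ?_ (by positivity) ?_ ?_ ?_ (by rw [hθ])
      (fun y hy => G.smoothedGap_linear_lower_bound hu hy)
      (G.smoothedGap_quadratic_upper_bound hμ hu hz'.1) hz'.1 hz'.2 hw'.1 hw'.2
    · rw [div_le_one (by positivity)]; linarith [k.cast_nonneg (α := ℝ)]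
    · push_cast; field_simp; nlinarith [k.cast_nonneg (α := ℝ)]
    · rw [hθ]; push_cast; field_simp; ring
    · push_cast; field_simp; ring

lemma iterate_mem_jointStates (he : 0 < e) (hD : 0 < regMax zref) (hz₀ : z₀ ∈ jointStates a b)
    (k : ℕ) : (G.smoothingState zref e z₀ k).iterate ∈ jointStates a b :=
  (G.nesterovInvariant_smoothingState he hD hz₀ k).iterate_mem

lemma mul_gap_iterate_sub_le (he : 0 < e) (hD : 0 < regMax zref) (hz₀ : z₀ ∈ jointStates a b)
    (k : ℕ) :
    k * (k + 1) * e * (G.gap (G.smoothingState zref e z₀ k).iterate - e / 2) ≤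
      4 * (G.opNorm ^ 2 * regMax zref * G.dist z₀ ^ 2) := by
  have hμ := (smoothingParam_pos he hD).le
  obtain ⟨y, hy, hdist⟩ := G.exists_dist_eq z₀
  rw [G.mem_opt_iff] at hy
  have hrate := (G.nesterovInvariant_smoothingState he hD hz₀ k).weight_mul_sub_le
    (div_nonneg (sq_nonneg _) hμ) hy.1
  have hgap : G.gap (G.smoothingState zref e z₀ k).iterate - e / 2 ≤
      G.smoothedGap zref (smoothingParam zref e) (G.smoothingState zref e z₀ k).iterate -
        G.smoothedGap zref (smoothingParam zref e) y := by
    have hlower := G.gap_le_smoothedGap_add (zref := zref) hμ (G.smoothingState zref e z₀ k).iterate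
    have hupper := G.smoothedGap_le_gap (zref := zref) hμ y
    rw [smoothingParam_mul_regMax hD.ne'] at hlower
    linarith
  rw [norm_sub_rev, ← hdist] at hrate
  calc k * (k + 1) * e * (G.gap (G.smoothingState zref e z₀ k).iterate - e / 2)
      = 4 * e * (k * (k + 1) / 4 * (G.gap (G.smoothingState zref e z₀ k).iterate - e / 2)) := by
        ring
    _ ≤ 4 * e * (G.lipConst zref e / 2 * G.dist z₀ ^ 2) := by
        gcongr 4 * e * ?_
        exact (mul_le_mul_of_nonneg_left hgap (by positivity)).trans hrate
    _ = 2 * (e * G.lipConst zref e) * G.dist z₀ ^ 2 := by ring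
    _ = 4 * (G.opNorm ^ 2 * regMax zref * G.dist z₀ ^ 2) := by
        rw [G.mul_lipConst he.ne' hD.ne']; ring

lemma gap_iterate_le (he : 0 < e) (hD : 0 < regMax zref) (hz₀ : z₀ ∈ jointStates a b) {k : ℕ}
    (hk : 1 ≤ k) (hle : 2 * √2 * G.opNorm * √(regMax zref) * G.dist z₀ ≤ k * e) :
    G.gap (G.smoothingState zref e z₀ k).iterate ≤ e := by
  have hk₀ : (0 : ℝ) < k := by exact_mod_cast hk
  have hsq : 8 * (G.opNorm ^ 2 * regMax zref * G.dist z₀ ^ 2) ≤ (k * e) ^ 2 := by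
    have := pow_le_pow_left₀ (mul_nonneg (mul_nonneg (mul_nonneg (by positivity) G.opNorm_nonneg)
      (Real.sqrt_nonneg _)) (G.dist_nonneg z₀)) hle 2
    simp only [mul_pow, Real.sq_sqrt zero_le_two, Real.sq_sqrt hD.le] at this
    linarith
  have hrate := G.mul_gap_iterate_sub_le he hD hz₀ k
  by_contra! hgt
  have : k * (k + 1) * e * (e / 2) <
      k * (k + 1) * e * (G.gap (G.smoothingState zref e z₀ k).iterate - e / 2) := by
    gcongr; linarith
  nlinarith [mul_pos hk₀ (mul_pos he he)]

end Convergence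

section IterationCount

variable {a b : ℕ} {Ω : Type*} [Fintype Ω] (G : QuantumGame a b Ω) {zref z₀ : JointMat a b}
  {γ e ε : ℝ}

variable (zref γ) in
/-- The bound, before rounding, on the number of first-order iterations of one call of the smoothing
procedure when the duality gap is to be reduced by the factor `γ`. -/
noncomputable def callBound : ℝ≥0∞ :=
  ENNReal.ofReal (2 * √2 * γ * G.opNorm * √(regMax zref)) / G.modulus

lemma opNorm_pos_of_gap_pos (hz₀ : z₀ ∈ jointStates a b) (hpos : 0 < G.gap z₀) : 0 < G.opNorm := by
  linarith [G.gap_le_two_mul_opNorm hz₀]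

lemma callBound_pos (hγ : 0 < γ) (hz₀ : z₀ ∈ jointStates a b) (hpos : 0 < G.gap z₀) :
    0 < G.callBound zref γ := by
  have hM := G.opNorm_pos_of_gap_pos hz₀ hpos
  have hD := G.regMax_pos_of_gap_pos zref hz₀ hpos
  exact ENNReal.div_pos (ENNReal.ofReal_pos.2 (by positivity)).ne'
    ((G.modulus_le_of_gap_pos hz₀ hpos).trans_lt ENNReal.ofReal_lt_top).ne

lemma gap_iterate_le_of_callBound_le (hγ : 0 < γ) (he : 0 < e) (hz₀ : z₀ ∈ jointStates a b)
    (hpos : 0 < G.gap z₀) (hgap : G.gap z₀ ≤ γ * e) {k : ℕ} (hk : 1 ≤ k)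
    (hle : G.callBound zref γ ≤ k) : G.gap (G.smoothingState zref e z₀ k).iterate ≤ e := by
  refine G.gap_iterate_le he (G.regMax_pos_of_gap_pos zref hz₀ hpos) hz₀ hk
    (le_of_mul_le_mul_left ?_ hγ)
  rw [callBound, ENNReal.div_le_iff_le_mul (.inr (ENNReal.natCast_ne_top k))
    (.inr (by exact_mod_cast (by omega : k ≠ 0)))] at hle
  rw [← ENNReal.ofReal_le_ofReal_iff (by positivity)]
  calc ENNReal.ofReal (γ * (2 * √2 * G.opNorm * √(regMax zref) * G.dist z₀))
      = ENNReal.ofReal (2 * √2 * γ * G.opNorm * √(regMax zref)) * ENNReal.ofReal (G.dist z₀) := by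
        rw [← ENNReal.ofReal_mul' (G.dist_nonneg z₀)]; ring_nf
    _ ≤ k * G.modulus * ENNReal.ofReal (G.dist z₀) := by gcongr
    _ ≤ k * ENNReal.ofReal (γ * e) := by
        rw [mul_assoc]
        gcongr
        exact (G.modulus_mul_dist_le_gap hz₀).trans (ENNReal.ofReal_le_ofReal hgap)
    _ = ENNReal.ofReal (γ * (k * e)) := by
        rw [← ENNReal.ofReal_natCast, ← ENNReal.ofReal_mul k.cast_nonneg]; ring_nf

lemma exists_smoothingReturns_of_gap_le {k₀ : ℕ} (hk₀ : 1 ≤ k₀)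
    (h : G.gap (G.smoothingState zref e z₀ k₀).iterate ≤ e) :
    ∃ k ≤ k₀, G.SmoothingReturns zref e z₀ k (G.smoothingState zref e z₀ k).iterate := by
  classical
  have hex : ∃ k, 1 ≤ k ∧ G.gap (G.smoothingState zref e z₀ k).iterate ≤ e := ⟨k₀, hk₀, h⟩
  refine ⟨Nat.find hex, Nat.find_min' hex ⟨hk₀, h⟩, (Nat.find_spec hex).1, rfl,
    (Nat.find_spec hex).2, fun j hj hlt => ?_⟩
  exact not_le.1 fun hle => Nat.find_min hex hlt ⟨hj, hle⟩

lemma exists_smoothingReturns (hγ : 0 < γ) (he : 0 < e) (hz₀ : z₀ ∈ jointStates a b)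
    (hpos : 0 < G.gap z₀) (hgap : G.gap z₀ ≤ γ * e) :
    ∃ (k : ℕ) (z : JointMat a b), G.SmoothingReturns zref e z₀ k z ∧ z ∈ jointStates a b ∧
      (k : ℕ∞) ≤ ENat.ceil (G.callBound zref γ) := by
  have hD := G.regMax_pos_of_gap_pos zref hz₀ hpos
  obtain ⟨k₀, hk₀, hreach, hbound⟩ : ∃ k₀ : ℕ, 1 ≤ k₀ ∧
      G.gap (G.smoothingState zref e z₀ k₀).iterate ≤ e ∧
      (k₀ : ℕ∞) ≤ ENat.ceil (G.callBound zref γ) := by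
    by_cases htop : ENat.ceil (G.callBound zref γ) = ⊤
    · obtain ⟨k₀, hk₀⟩ := exists_nat_ge (2 * √2 * G.opNorm * √(regMax zref) * G.dist z₀ / e)
      refine ⟨k₀ + 1, k₀.succ_pos, G.gap_iterate_le he hD hz₀ k₀.succ_pos ?_, htop ▸ le_top⟩
      rw [div_le_iff₀ he] at hk₀
      push_cast
      linarith
    · obtain ⟨k₀, hk₀⟩ := ENat.ne_top_iff_exists.1 htop
      have hone : 1 ≤ k₀ := by
        have := ENat.ceil_pos.2 (G.callBound_pos (zref := zref) hγ hz₀ hpos)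
        rw [← hk₀] at this
        exact_mod_cast this
      have hle : G.callBound zref γ ≤ k₀ := by
        
        have := ENat.le_ceil_self (r := G.callBound zref γ)
        rwa [← hk₀, ENat.toENNReal_coe] at this
      exact ⟨k₀, hone, G.gap_iterate_le_of_callBound_le hγ he hz₀ hpos hgap hone hle, hk₀.le⟩
  obtain ⟨k, hk, hreturns⟩ := G.exists_smoothingReturns_of_gap_le hk₀ hreach
  exact ⟨k, _, hreturns, G.iterate_mem_jointStates he hD hz₀ k,
    (Nat.cast_le.2 hk).trans hbound⟩

lemma exists_outerLoop (zref : JointMat a b) (hγ : 0 < γ) (hε : 0 < ε) (N : ℕ) {z : JointMat a b}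
    (hz : z ∈ jointStates a b) (hgap : G.gap z ≤ e) (he : e ≤ ε * γ ^ N) :
    ∃ (n : ℕ) (out : JointMat a b), G.OuterLoop zref γ ε z e n out ∧
      G.IsEpsEquilibrium ε out ∧ (n : ℕ∞) ≤ N * ENat.ceil (G.callBound zref γ) := by
  induction N generalizing z e with
  | zero =>
    have hhalt : G.gap z ≤ ε := by linarith
    exact ⟨0, z, .halt hhalt, ⟨hz, hhalt⟩, by simp⟩
  | succ N ih =>
    obtain hhalt | hgt := le_or_gt (G.gap z) ε
    · exact ⟨0, z, .halt hhalt, ⟨hz, hhalt⟩, by simp⟩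
    have hpos := hε.trans hgt
    obtain ⟨k, z', hcall, hz', hk⟩ := G.exists_smoothingReturns (zref := zref) hγ
      (div_pos (hpos.trans_le hgap) hγ) hz hpos (hgap.trans_eq (mul_div_cancel₀ e hγ.ne').symm)
    obtain ⟨n, out, hrest, hout, hn⟩ := ih hz' hcall.2.2.1
      (by rwa [div_le_iff₀ hγ, mul_assoc, ← pow_succ])
    refine ⟨k + n, out, .restart hgt hcall hrest, hout, ?_⟩
    push_cast
    rw [add_mul, one_mul, add_comm]
    exact add_le_add hn hk

lemma exists_iterSmooth (zref : JointMat a b) (hγ : 1 < γ) (hε : 0 < ε)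
    (hz₀ : z₀ ∈ jointStates a b) :
    ∃ (n : ℕ) (out : JointMat a b), G.IterSmooth zref γ ε z₀ n out ∧ G.IsEpsEquilibrium ε out ∧
      (n : ℕ∞) ≤ (⌈Real.log (2 * G.opNorm / ε) / Real.log γ⌉₊ : ℕ∞) *
        ENat.ceil (G.callBound zref γ) := by
  obtain hhalt | hgt := le_or_gt (G.gap z₀) ε
  · exact ⟨0, z₀, .halt hhalt, ⟨hz₀, hhalt⟩, by simp⟩
  have hM := G.opNorm_pos_of_gap_pos hz₀ (hε.trans hgt)
  have hγ₀ : 0 < γ := zero_lt_one.trans hγ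
  have hcalls := Nat.le_ceil (Real.log (2 * G.opNorm / ε) / Real.log γ)
  rw [div_le_iff₀ (Real.log_pos hγ), ← Real.log_pow,
    Real.log_le_log_iff (by positivity) (by positivity), div_le_iff₀' hε] at hcalls
  exact G.exists_outerLoop zref hγ₀ hε _ hz₀ le_rfl ((G.gap_le_two_mul_opNorm hz₀).trans hcalls)

end IterationCount

end QuantumGame

section ConditionMeasure

lemma natCeil_log_two_mul_div_log_le {γ x : ℝ} (hγ : 1 < γ) (hx : 2 ≤ x) :
    (⌈Real.log (2 * x) / Real.log γ⌉₊ : ℝ) ≤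
      (2 / Real.log γ + 1 / Real.log 2) * Real.log x := by
  have hlogγ := Real.log_pos hγ
  have hlog2 := Real.log_pos one_lt_two
  have hlog : Real.log 2 ≤ Real.log x := Real.log_le_log two_pos hx
  calc (⌈Real.log (2 * x) / Real.log γ⌉₊ : ℝ)
      ≤ Real.log (2 * x) / Real.log γ + 1 :=
        (Nat.ceil_lt_add_one (div_nonneg (Real.log_nonneg (by linarith)) hlogγ.le)).le
    _ = (Real.log 2 + Real.log x) / Real.log γ + Real.log 2 / Real.log 2 := by
        rw [Real.log_mul two_ne_zero (by positivity), div_self hlog2.ne']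
    _ ≤ (Real.log x + Real.log x) / Real.log γ + Real.log x / Real.log 2 := by gcongr
    _ = (2 / Real.log γ + 1 / Real.log 2) * Real.log x := by ring

lemma coe_ennrealCeil_le_add_one (r : ℝ≥0∞) : (ENat.ceil r : ℝ≥0∞) ≤ r + 1 :=
  calc (ENat.ceil r : ℝ≥0∞) ≤ (ENat.floor r : ℝ≥0∞) + 1 :=
        mod_cast ENat.ceil_le_floor_add_one r
    _ ≤ r + 1 := by gcongr; exact ENat.floor_le_self

namespace QuantumGame

variable {a b : ℕ} {Ω : Type*} [Fintype Ω] (G : QuantumGame a b Ω) {zref z₀ : JointMat a b}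
  {γ ε : ℝ}

lemma one_le_sqrt_two_mul_condMeasure (hz₀ : z₀ ∈ jointStates a b) (hpos : 0 < G.gap z₀) :
    1 ≤ ENNReal.ofReal √2 * G.condMeasure := by
  have hM := G.opNorm_pos_of_gap_pos hz₀ hpos
  rw [condMeasure, ← mul_div_assoc, ← ENNReal.ofReal_mul (Real.sqrt_nonneg 2),
    ENNReal.le_div_iff_mul_le (.inr (ENNReal.ofReal_pos.2 (by positivity)).ne')
      (.inr ENNReal.ofReal_ne_top), one_mul]
  exact G.modulus_le_of_gap_pos hz₀ hpos

lemma callBound_eq_mul_condMeasure (hγ : 0 ≤ γ) :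
    G.callBound zref γ = ENNReal.ofReal (2 * √2 * γ * √(regMax zref)) * G.condMeasure := by
  rw [callBound, condMeasure, ← mul_div_assoc, ← ENNReal.ofReal_mul (by positivity)]
  ring_nf

lemma ceil_callBound_le (hγ : 1 ≤ γ) (hz₀ : z₀ ∈ jointStates a b) (hpos : 0 < G.gap z₀) :
    (ENat.ceil (G.callBound zref γ) : ℝ≥0∞) ≤
      ENNReal.ofReal (2 * √2 * γ * (1 + √(regMax zref))) * G.condMeasure :=
  calc (ENat.ceil (G.callBound zref γ) : ℝ≥0∞)
      ≤ G.callBound zref γ + 1 := coe_ennrealCeil_le_add_one _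
    _ ≤ ENNReal.ofReal (2 * √2 * γ * √(regMax zref)) * G.condMeasure +
        ENNReal.ofReal √2 * G.condMeasure := by
      rw [G.callBound_eq_mul_condMeasure (zero_le_one.trans hγ)]
      gcongr
      exact G.one_le_sqrt_two_mul_condMeasure hz₀ hpos
    _ ≤ ENNReal.ofReal (2 * √2 * γ * (1 + √(regMax zref))) * G.condMeasure := by
      rw [← add_mul, ← ENNReal.ofReal_add (by positivity) (by positivity)]
      gcongr
      nlinarith [Real.sqrt_nonneg 2]

lemma natCast_le_of_le_mul_ceil_callBound (hγ : 1 < γ) (hε : 0 < ε) (hle : ε ≤ G.opNorm / 2)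
    (hz₀ : z₀ ∈ jointStates a b) (hpos : 0 < G.gap z₀) {n : ℕ}
    (hn : (n : ℕ∞) ≤ (⌈Real.log (2 * G.opNorm / ε) / Real.log γ⌉₊ : ℕ∞) *
      ENat.ceil (G.callBound zref γ)) :
    (n : ℝ≥0∞) ≤ ENNReal.ofReal ((2 / Real.log γ + 1 / Real.log 2) * (2 * √2 * γ) *
      (1 + √(regMax zref))) * G.condMeasure * ENNReal.ofReal (Real.log (G.opNorm / ε)) := by
  have hcalls := natCeil_log_two_mul_div_log_le (x := G.opNorm / ε) hγ
    ((le_div_iff₀ hε).2 (by linarith))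
  rw [← mul_div_assoc] at hcalls
  have hlogγ := Real.log_pos hγ
  calc (n : ℝ≥0∞) ≤ (⌈Real.log (2 * G.opNorm / ε) / Real.log γ⌉₊ : ℝ≥0∞) *
        (ENat.ceil (G.callBound zref γ) : ℝ≥0∞) := mod_cast hn
    _ ≤ ENNReal.ofReal ((2 / Real.log γ + 1 / Real.log 2) * Real.log (G.opNorm / ε)) *
        (ENNReal.ofReal (2 * √2 * γ * (1 + √(regMax zref))) * G.condMeasure) := by
      rw [← ENNReal.ofReal_natCast]
      gcongr
      exact G.ceil_callBound_le hγ.le hz₀ hpos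
    _ = _ := by
      have hc : 0 ≤ 2 / Real.log γ + 1 / Real.log 2 := by positivity
      rw [mul_assoc _ (2 * √2 * γ), ENNReal.ofReal_mul hc, ENNReal.ofReal_mul hc]
      ring

end QuantumGame

end ConditionMeasure

theorem theorem4p1_general (γ : ℝ) (hγ : 1 < γ) :
    (∃ C : ℝ, 0 < C ∧
      ∀ (a b : ℕ) (Ω : Type*) [Fintype Ω] (G : QuantumGame a b Ω) (zref z₀ : JointMat a b),
        z₀ ∈ jointStates a b → ∀ ε : ℝ, 0 < ε → ε ≤ G.opNorm / 2 →
          ∃ (n : ℕ) (out : JointMat a b),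
            G.IterSmooth zref γ ε z₀ n out ∧ G.IsEpsEquilibrium ε out ∧
            (n : ℝ≥0∞) ≤ ENNReal.ofReal (C * (1 + √(regMax zref))) * G.condMeasure *
              ENNReal.ofReal (Real.log (G.opNorm / ε))) ∧
    (∀ (a b : ℕ) (Ω : Type*) [Fintype Ω] (G : QuantumGame a b Ω) (zref z₀ : JointMat a b),
        z₀ ∈ jointStates a b → ∀ ε : ℝ, 0 < ε →
          ∃ (n : ℕ) (out : JointMat a b),
            G.IterSmooth zref γ ε z₀ n out ∧ G.IsEpsEquilibrium ε out ∧
            (n : ℕ∞) ≤ (⌈Real.log (2 * G.opNorm / ε) / Real.log γ⌉₊ : ℕ∞) *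
              ENat.ceil (G.callBound zref γ)) := by
  have hlogγ := Real.log_pos hγ
  refine ⟨⟨(2 / Real.log γ + 1 / Real.log 2) * (2 * √2 * γ), by positivity, ?_⟩,
    fun a b Ω _ G zref z₀ hz₀ ε hε => G.exists_iterSmooth zref hγ hε hz₀⟩
  intro a b Ω _ G zref z₀ hz₀ ε hε hle
  obtain hhalt | hgt := le_or_gt (G.gap z₀) ε
  · exact ⟨0, z₀, .halt hhalt, ⟨hz₀, hhalt⟩, by simp⟩
  obtain ⟨n, out, hrun, hout, hn⟩ := G.exists_iterSmooth zref hγ hε hz₀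
  exact ⟨n, out, hrun, hout,
    G.natCast_le_of_le_mul_ceil_callBound hγ hε hle hz₀ (hε.trans hgt) hn⟩

theorem theorem4p1 (γ : ℝ) (hγ : 1 < γ) :
    (∃ C : ℝ, 0 < C ∧
      ∀ (a b : ℕ) (Ω : Type*) [Fintype Ω] (G : QuantumGame a b Ω) (zref z₀ : JointMat a b),
        zref ∈ jointStates a b → z₀ ∈ jointStates a b →
        ∀ ε : ℝ, 0 < ε → ε ≤ G.opNorm / 2 →
          ∃ (n : ℕ) (out : JointMat a b),
            G.IterSmooth zref γ ε z₀ n out ∧ G.IsEpsEquilibrium ε out ∧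
            (n : ℝ≥0∞) ≤
              ENNReal.ofReal C * G.condMeasure * ENNReal.ofReal (Real.log (G.opNorm / ε))) ∧
    (∀ (a b : ℕ) (Ω : Type*) [Fintype Ω] (G : QuantumGame a b Ω) (zref z₀ : JointMat a b),
        zref ∈ jointStates a b → z₀ ∈ jointStates a b →
        ∀ ε : ℝ, 0 < ε →
          ∃ (n : ℕ) (out : JointMat a b),
            G.IterSmooth zref γ ε z₀ n out ∧ G.IsEpsEquilibrium ε out ∧
            (n : ℕ∞) ≤
              (⌈Real.log (2 * G.opNorm / ε) / Real.log γ⌉₊ : ℕ∞) *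
                ENat.ceil (ENNReal.ofReal
                  (2 * Real.sqrt 2 * γ * G.opNorm * Real.sqrt (regMax zref)) / G.modulus)) := by
  obtain ⟨⟨C, hC, hpart1⟩, hpart2⟩ := theorem4p1_general γ hγ
  refine ⟨⟨C * 3, by positivity, fun a b Ω _ G zref z₀ hzref hz₀ ε hε hle => ?_⟩,
    fun a b Ω _ G zref z₀ _ hz₀ ε hε => hpart2 a b Ω G zref z₀ hz₀ ε hε⟩
  have hD : 1 + √(regMax zref) ≤ 3 := by
    linarith [Real.sqrt_le_iff.2 ⟨zero_le_two, (regMax_le_four hzref).trans_eq (by norm_num)⟩]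
  obtain ⟨n, out, hrun, hout, hn⟩ := hpart1 a b Ω G zref z₀ hz₀ ε hε hle
  exact ⟨n, out, hrun, hout, hn.trans (by gcongr)⟩
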